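/- Consider the planar Stark problem $$\ddot x=-\frac{x}{r^3}+1,\qquad \ddot y=-\frac{y}{r^3},\qquad r=\sqrt{x^2+y^2}.$$ A brake orbit is a periodic solution whose velocity vanishes at some time; a collision orbit is a solution that tends to the origin as $t$ tends to some finite time. For every $a'\in(-1,1)$ there exist $k_b\in\mathbb N$ and two sequences of positive numbers $(d_k)_{k\ge k_b}$ and $(d'_k)_{k\ge k_b}$ with the following properties. (i) For every $k\ge k_b$, the solution $A'_k$ with initial position $(x(0),y(0))=(a',d_k)$ and zero initial velocity is a brake orbit which, in the time after $0$, intersects the positive $x$-axis exactly $k$ times before it first reaches the negative $x$-axis, and there it intersects the negative $x$-axis perpendicularly. (ii) For every $k\ge k_b$, the solution $B'_k$ with initial position $(x(0),y(0))=(a',d'_k)$ and zero initial velocity is a collision orbit which intersects the positive $x$-axis exactly $k$ times between time $0$ and the collision. (iii) $\lim_{k\to\infty}d_k=\lim_{k\to\infty}d'_k=\sqrt{1-a'^2}$. (iv) $d_k<d'_k<d_{k+1}$ for all $k\ge k_b$. Moreover $k_b\to+\infty$ as $a'\to1^-$, in the sense that this holds for every choice, for each $a'\in(-1,1)$, of an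 index $k_b=k_b(a')$ for which such sequences exist (in particular for the smallest one). -/

import Mathlib

open Set Filter Topology

/-- `(x, y)` with velocity `(u, v)` is a collision-free solution, at every time of `I`, of the planar
Stark problem `x'' = -x / r ^ 3 + 1`, `y'' = -y / r ^ 3`, where `r = √(x ^ 2 + y ^ 2)`.
(`I` is an open set of times below, so two-sided derivatives are the right ones.) -/
structure IsStarkSolutionOn (x y u v : ℝ → ℝ) (I : Set ℝ) : Prop where
  ne_zero : ∀ t ∈ I, x t ≠ 0 ∨ y t ≠ 0
  deriv_x : ∀ t ∈ I, HasDerivAt x (u t) t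
  deriv_y : ∀ t ∈ I, HasDerivAt y (v t) t
  deriv_u : ∀ t ∈ I, HasDerivAt u (-(x t / Real.sqrt (x t ^ 2 + y t ^ 2) ^ 3) + 1) t
  deriv_v : ∀ t ∈ I, HasDerivAt v (-(y t / Real.sqrt (x t ^ 2 + y t ^ 2) ^ 3)) t

/-- At time `0` the particle is at rest at the point `(a, d)`. -/
structure StartsAtRest (x y u v : ℝ → ℝ) (a d : ℝ) : Prop where
  x_zero : x 0 = a
  y_zero : y 0 = d
  u_zero : u 0 = 0
  v_zero : v 0 = 0

/-- A brake orbit: a periodic solution whose velocity vanishes at some time. -/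
structure IsBrakeOrbit (x y u v : ℝ → ℝ) : Prop where
  solution : IsStarkSolutionOn x y u v univ
  periodic : ∃ P : ℝ, 0 < P ∧ Function.Periodic x P ∧ Function.Periodic y P
  brake : ∃ t : ℝ, u t = 0 ∧ v t = 0

/-- The times strictly between `0` and `T` at which the orbit is on the positive `x`-axis. -/
def positiveAxisTimes (x y : ℝ → ℝ) (T : ℝ) : Set ℝ :=
  {t | t ∈ Ioo 0 T ∧ y t = 0 ∧ 0 < x t}

/-- At time `T` the orbit intersects the negative `x`-axis perpendicularly. -/
def HitsNegativeAxisPerpendicularly (x y u v : ℝ → ℝ) (T : ℝ) : Prop :=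
  y T = 0 ∧ x T < 0 ∧ u T = 0 ∧ v T ≠ 0

/-- The orbit starting at rest at `(a, d)` is a brake orbit which, after the time `0`, intersects the
positive `x`-axis exactly `k` times before its first arrival (at time `T`) on the negative
`x`-axis, where it is perpendicular to that axis. -/
def IsTypeA (a d : ℝ) (k : ℕ) : Prop :=
  ∃ x y u v : ℝ → ℝ, StartsAtRest x y u v a d ∧ IsBrakeOrbit x y u v ∧
    ∃ T : ℝ, 0 < T ∧ HitsNegativeAxisPerpendicularly x y u v T ∧
      (∀ t ∈ Ioo 0 T, y t = 0 → 0 < x t) ∧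
      (positiveAxisTimes x y T).encard = (k : ℕ∞)

/-- The orbit starting at rest at `(a, d)` collides with the origin at a time `T > 0`, and it
intersects the positive `x`-axis exactly `k` times between the time `0` and the collision. -/
def IsTypeB (a d : ℝ) (k : ℕ) : Prop :=
  ∃ x y u v : ℝ → ℝ, StartsAtRest x y u v a d ∧
    ∃ S T : ℝ, S < 0 ∧ 0 < T ∧ IsStarkSolutionOn x y u v (Ioo S T) ∧
      Tendsto x (𝓝[<] T) (𝓝 0) ∧ Tendsto y (𝓝[<] T) (𝓝 0) ∧
      (positiveAxisTimes x y T).encard = (k : ℕ∞)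

/-- The number `kb` is an admissible first index for the abscissa `a`: there are sequences
`d k`, `d' k` (for `k ≥ kb`) with all the required properties. -/
def IsAdmissibleIndex (a : ℝ) (kb : ℕ) : Prop :=
  ∃ d d' : ℕ → ℝ,
    (∀ k : ℕ, kb ≤ k → 0 < d k ∧ IsTypeA a (d k) k) ∧
    (∀ k : ℕ, kb ≤ k → 0 < d' k ∧ IsTypeB a (d' k) k) ∧
    Tendsto d atTop (𝓝 (Real.sqrt (1 - a ^ 2))) ∧
    Tendsto d' atTop (𝓝 (Real.sqrt (1 - a ^ 2))) ∧
    (∀ k : ℕ, kb ≤ k → d k < d' k ∧ d' k < d (k + 1))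

/-! In Levi-Civita coordinates `x = (ξ ^ 2 - η ^ 2) / 2`, `y = ξ * η`, with a new time `s` such that
`dt = (ξ ^ 2 + η ^ 2) ds`, the Stark problem separates: for energy `h` it becomes `ξ'' = 2hξ + 2ξ³`,
`η'' = 2hη - 2η³`. Start at rest at distance `r < 1` from the origin, so that `h = -1 / r - a`. Both
coordinates then start at a maximum and oscillate as `ξ = √(r + a) cos θ`, `η = √(r - a) cos φ`,
where the phases solve autonomous first-order equations. The zeros of `ξ` are the passages through
the negative `x`-axis, those of `η` the passages through the positive one, and common zeros are
collisions.

Let `n` be the ratio of the quarter period of `ξ` to that of `η`, and suppose it is an integer. At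
the first zero of `ξ`, the phase `φ` equals `nπ/2`. If `n = 2k`, then `η` is extremal there, which
gives the perpendicular crossing of a periodic orbit (`isTypeA_of_resonance`); if `n = 2k + 1`, then
`η` vanishes too, which gives a collision (`isTypeB_of_resonance`). In both cases `η` has `k`
earlier zeros. As `r → 1⁻`, the `ξ`-motion starts closer and closer to a saddle, so its quarter
period diverges logarithmically while that of `η` stays bounded (`tendsto_quarterPeriod_ratio`). The
ratio therefore takes every large integer value; the last radii at which it does so increase to `1`
(`exists_last_crossings`), and even and odd `n` interlace.

For the growth of the index, an orbit starting at rest near the equilibrium `(1, 0)` stays near it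
for a long time (`near_equilibrium`), while `y'' = -y / r³` forces `y` to keep vanishing there
(`exists_zero_of_sturm`). It thus meets the positive axis too often to be of type A with a small
`k`. -/

/-! ### Time changes and phases by quadrature -/

/-- The primitive of `p` that vanishes at `0`. -/
noncomputable def primitive (p : ℝ → ℝ) (s : ℝ) : ℝ := ∫ w in (0 : ℝ)..s, p w

theorem primitive_zero (p : ℝ → ℝ) : primitive p 0 = 0 := by simp [primitive]

theorem hasDerivAt_primitive {p : ℝ → ℝ} (hp : Continuous p) (s : ℝ) :
    HasDerivAt (primitive p) (p s) s :=
  intervalIntegral.integral_hasDerivAt_right (hp.intervalIntegrable _ _)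
    hp.stronglyMeasurable.stronglyMeasurableAtFilter hp.continuousAt

theorem continuous_primitive {p : ℝ → ℝ} (hp : Continuous p) : Continuous (primitive p) :=
  continuous_iff_continuousAt.2 fun s => (hasDerivAt_primitive hp s).continuousAt

theorem primitive_add_period {p : ℝ → ℝ} (hp : Continuous p) {P : ℝ} (hper : Function.Periodic p P)
    (s : ℝ) : primitive p (s + P) = primitive p s + primitive p P := by
  unfold primitive
  rw [← intervalIntegral.integral_add_adjacent_intervals (hp.intervalIntegrable 0 s)
    (hp.intervalIntegrable s (s + P)), hper.intervalIntegral_add_eq s 0, zero_add]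

theorem primitive_neg {p : ℝ → ℝ} (heven : ∀ s, p (-s) = p s) (s : ℝ) :
    primitive p (-s) = -primitive p s := by
  unfold primitive
  have := intervalIntegral.integral_comp_neg (a := 0) (b := s) p
  simp only [heven, neg_zero] at this
  rw [this, intervalIntegral.integral_symm]

theorem strictMono_primitive_of_pos {p : ℝ → ℝ} (hp : Continuous p) (hpos : ∀ s, 0 < p s) :
    StrictMono (primitive p) :=
  strictMono_of_hasDerivAt_pos (fun s => hasDerivAt_primitive hp s) hpos

/-- The inverse of the strictly increasing primitive of a periodic function. -/
theorem exists_inverse_primitive {p : ℝ → ℝ} (hp : Continuous p) {P : ℝ} (hP : 0 < P)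
    (hper : Function.Periodic p P) (hmono : StrictMono (primitive p)) :
    ∃ g : ℝ → ℝ, (∀ s, g (primitive p s) = s) ∧ (∀ t, primitive p (g t) = t) ∧ StrictMono g ∧
      Continuous g ∧ ∀ t, p (g t) ≠ 0 → HasDerivAt g (p (g t))⁻¹ t := by
  have hpos : 0 < ∫ x in (0 : ℝ)..P, p x := by
    have := hmono hP
    rwa [primitive_zero] at this
  have hsurj : Function.Surjective (primitive p) :=
    (continuous_primitive hp).surjective
      (hper.tendsto_atTop_intervalIntegral_of_pos hpos hP)
      (hper.tendsto_atBot_intervalIntegral_of_pos hpos hP)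
  let e := hmono.orderIsoOfSurjective _ hsurj
  refine ⟨e.symm, fun s => e.symm_apply_apply s, fun t => e.apply_symm_apply t,
    e.symm.strictMono, e.symm.continuous, fun t ht => ?_⟩
  exact HasDerivAt.of_local_left_inverse e.symm.continuous.continuousAt
    (hasDerivAt_primitive hp _) ht (Eventually.of_forall fun t => e.apply_symm_apply t)

/-- The time that the solution of `θ' = f θ` needs from `0` to `π / 2`. -/
noncomputable def quarterPeriod (f : ℝ → ℝ) : ℝ := ∫ w in (0 : ℝ)..(Real.pi / 2), (f w)⁻¹

theorem quarterPeriod_pos {f : ℝ → ℝ} (hf : Continuous f) (hpos : ∀ s, 0 < f s) :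
    0 < quarterPeriod f := by
  have := strictMono_primitive_of_pos (hf.inv₀ fun s => (hpos s).ne')
    (fun s => inv_pos.2 (hpos s)) Real.pi_div_two_pos
  rwa [primitive_zero] at this

/-- The global solution of `θ' = f θ`, `θ 0 = 0`, for an even positive `f` of period `π`. -/
theorem exists_phase {f : ℝ → ℝ} (hf : Continuous f) (hpos : ∀ s, 0 < f s)
    (hper : Function.Periodic f Real.pi) (heven : ∀ s, f (-s) = f s) :
    ∃ θ : ℝ → ℝ, StrictMono θ ∧ Continuous θ ∧ Function.Surjective θ ∧
      (∀ s, HasDerivAt θ (f (θ s)) s) ∧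
      (∀ m : ℤ, θ (m * quarterPeriod f) = m * (Real.pi / 2)) ∧
      (∀ m : ℤ, ∀ s, θ (s + m * (2 * quarterPeriod f)) = θ s + m * Real.pi) := by
  set p : ℝ → ℝ := fun s => (f s)⁻¹ with hpdef
  have hp : Continuous p := hf.inv₀ fun s => (hpos s).ne'
  have hp0 : ∀ s, 0 < p s := fun s => inv_pos.2 (hpos s)
  have hpp : Function.Periodic p Real.pi := fun s => by simp [hpdef, hper s]
  have hq : primitive p (Real.pi / 2) = quarterPeriod f := rfl
  obtain ⟨θ, h1, h2, h3, h4, h5⟩ :=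
    exists_inverse_primitive hp Real.pi_pos hpp (strictMono_primitive_of_pos hp hp0)
  have hpi : primitive p Real.pi = 2 * quarterPeriod f := by
    -- A shift by `π` carries `-π/2` to `π/2`, and the primitive is odd, so a period is two
    -- quarters.
    have := primitive_add_period hp hpp (-(Real.pi / 2))
    rw [primitive_neg (fun s => by simp [hpdef, heven s]), show -(Real.pi / 2) + Real.pi = Real.pi / 2 by ring,
      hq] at this
    linarith
  have hadd : ∀ m : ℤ, ∀ s, primitive p (s + m * Real.pi)
      = primitive p s + m * (2 * quarterPeriod f) := by
    -- Subtracting the mean linear growth leaves a periodic function, which settles all integer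
    -- shifts at once.
    have hP : Function.Periodic (fun s => primitive p s - s / Real.pi * (2 * quarterPeriod f))
        Real.pi := fun s => by
      simp only
      rw [primitive_add_period hp hpp, hpi]
      have := Real.pi_pos.ne'
      field_simp
      ring
    intro m s
    have := hP.int_mul m s
    have h0 := Real.pi_pos.ne'
    have h6 : (s + m * Real.pi) / Real.pi = s / Real.pi + m := by field_simp
    rw [h6] at this
    linarith
  refine ⟨θ, h3, h4, fun s => ⟨_, h1 s⟩, fun s => by simpa [hpdef] using h5 s (hp0 _).ne', ?_, ?_⟩
  · intro m
    rw [← h1 (m * (Real.pi / 2))]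
    congr 1
    rcases Int.even_or_odd' m with ⟨j, rfl | rfl⟩
    · have := hadd j 0
      rw [primitive_zero, zero_add, zero_add] at this
      push_cast
      rw [show 2 * (j : ℝ) * (Real.pi / 2) = j * Real.pi by ring, this]
      ring
    · have := hadd j (Real.pi / 2)
      rw [hq] at this
      push_cast
      rw [show (2 * (j : ℝ) + 1) * (Real.pi / 2) = Real.pi / 2 + j * Real.pi by ring, this]
      ring
  · intro m s
    rw [← h1 (θ s + m * Real.pi), hadd, h2]

/-! ### Levi-Civita regularization -/

/-- A solution of the Levi-Civita regularized equations, in the regularizing time, gives a solution of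
the Stark problem in the physical time, as long as there is no collision. -/
theorem isStarkSolutionOn_of_regularized {ξ η α β g : ℝ → ℝ} {h : ℝ} {I : Set ℝ}
    (hξ : ∀ s, HasDerivAt ξ (α s) s) (hη : ∀ s, HasDerivAt η (β s) s)
    (hα : ∀ s, HasDerivAt α (2 * h * ξ s + 2 * ξ s ^ 3) s)
    (hβ : ∀ s, HasDerivAt β (2 * h * η s - 2 * η s ^ 3) s)
    (henergy : ∀ s, α s ^ 2 + β s ^ 2
      = 4 + 2 * h * (ξ s ^ 2 + η s ^ 2) + (ξ s ^ 4 - η s ^ 4))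
    (hne : ∀ t ∈ I, ξ (g t) ^ 2 + η (g t) ^ 2 ≠ 0)
    (hg : ∀ t ∈ I, HasDerivAt g (ξ (g t) ^ 2 + η (g t) ^ 2)⁻¹ t) :
    IsStarkSolutionOn (fun t => (ξ (g t) ^ 2 - η (g t) ^ 2) / 2) (fun t => ξ (g t) * η (g t))
      (fun t => (ξ (g t) * α (g t) - η (g t) * β (g t)) / (ξ (g t) ^ 2 + η (g t) ^ 2))
      (fun t => (α (g t) * η (g t) + ξ (g t) * β (g t)) / (ξ (g t) ^ 2 + η (g t) ^ 2)) I := by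
  have hsqrt : ∀ b c : ℝ, Real.sqrt (((b ^ 2 - c ^ 2) / 2) ^ 2 + (b * c) ^ 2)
      = (b ^ 2 + c ^ 2) / 2 := fun b c => by
    rw [show ((b ^ 2 - c ^ 2) / 2) ^ 2 + (b * c) ^ 2 = ((b ^ 2 + c ^ 2) / 2) ^ 2 by ring]
    exact Real.sqrt_sq (by positivity)
  have key : ∀ t ∈ I, HasDerivAt (fun t => ξ (g t)) (α (g t) * (ξ (g t) ^ 2 + η (g t) ^ 2)⁻¹) t ∧
      HasDerivAt (fun t => η (g t)) (β (g t) * (ξ (g t) ^ 2 + η (g t) ^ 2)⁻¹) t ∧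
      HasDerivAt (fun t => α (g t))
        ((2 * h * ξ (g t) + 2 * ξ (g t) ^ 3) * (ξ (g t) ^ 2 + η (g t) ^ 2)⁻¹) t ∧
      HasDerivAt (fun t => β (g t))
        ((2 * h * η (g t) - 2 * η (g t) ^ 3) * (ξ (g t) ^ 2 + η (g t) ^ 2)⁻¹) t :=
    fun t ht => ⟨(hξ _).comp t (hg t ht), (hη _).comp t (hg t ht), (hα _).comp t (hg t ht),
      (hβ _).comp t (hg t ht)⟩
  refine ⟨fun t ht => ?_, fun t ht => ?_, fun t ht => ?_, fun t ht => ?_, fun t ht => ?_⟩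
  · by_contra! hcon
    apply hne t ht
    have := hsqrt (ξ (g t)) (η (g t))
    rw [hcon.1, hcon.2] at this
    simp at this
    linarith
  all_goals
    obtain ⟨k1, k2, k3, k4⟩ := key t ht
    have hn := hne t ht
    have he := henergy (g t)
  · refine (((k1.pow 2).sub (k2.pow 2)).div_const 2).congr_deriv ?_
    field_simp
    ring
  · refine (k1.mul k2).congr_deriv ?_
    field_simp
  · refine (((k1.mul k3).sub (k2.mul k4)).div ((k1.pow 2).add (k2.pow 2)) hn).congr_deriv ?_
    simp only [hsqrt, Pi.add_apply, Pi.sub_apply, Pi.mul_apply, Pi.pow_apply]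
    generalize ξ (g t) = b at *
    generalize η (g t) = c at *
    generalize α (g t) = A at *
    generalize β (g t) = B at *
    field_simp
    -- Differentiating the velocity leaves a term in `A ^ 2 + B ^ 2`, which the energy relation
    -- eliminates.
    linear_combination (-(b ^ 2 - c ^ 2)) * he
  · refine (((k3.mul k2).add (k1.mul k4)).div ((k1.pow 2).add (k2.pow 2)) hn).congr_deriv ?_
    simp only [hsqrt, Pi.add_apply, Pi.mul_apply, Pi.pow_apply]
    generalize ξ (g t) = b at *
    generalize η (g t) = c at *
    generalize α (g t) = A at *
    generalize β (g t) = B at *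
    field_simp
    linear_combination (-2 * b * c) * he

/-! ### Phase equations of the separated coordinates -/

/-- The speed of the phase of the coordinate `ξ = √(r + a) cos θ`. -/
noncomputable def speedXi (a r θ : ℝ) : ℝ :=
  Real.sqrt (2 / r - 2 * r + (r + a) * Real.sin θ ^ 2)

/-- The speed of the phase of the coordinate `η = √(r - a) cos φ`. -/
noncomputable def speedEta (a r φ : ℝ) : ℝ :=
  Real.sqrt (r + a + 2 / r + (r - a) * Real.cos φ ^ 2)

theorem radicandXi_pos {a r : ℝ} (ha : |a| < r) (hr : r < 1) (θ : ℝ) :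
    0 < 2 / r - 2 * r + (r + a) * Real.sin θ ^ 2 := by
  have h0 : 0 < r := (abs_nonneg a).trans_lt ha
  have h1 : 0 < r + a := by linarith [neg_abs_le a]
  have h2 : 2 < 2 / r := by rw [lt_div_iff₀ h0]; linarith
  have := mul_nonneg h1.le (sq_nonneg (Real.sin θ))
  linarith

theorem two_le_radicandEta {a r : ℝ} (ha : |a| < r) (hr : r < 1) (φ : ℝ) :
    2 ≤ r + a + 2 / r + (r - a) * Real.cos φ ^ 2 := by
  have h0 : 0 < r := (abs_nonneg a).trans_lt ha
  have h1 : 0 < r + a := by linarith [neg_abs_le a]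
  have h2 : 2 < 2 / r := by rw [lt_div_iff₀ h0]; linarith
  have := mul_nonneg (sub_nonneg.2 ((le_abs_self a).trans ha.le)) (sq_nonneg (Real.cos φ))
  linarith

theorem speedXi_pos {a r : ℝ} (ha : |a| < r) (hr : r < 1) (θ : ℝ) : 0 < speedXi a r θ :=
  Real.sqrt_pos.2 (radicandXi_pos ha hr θ)

theorem speedEta_pos {a r : ℝ} (ha : |a| < r) (hr : r < 1) (φ : ℝ) : 0 < speedEta a r φ :=
  Real.sqrt_pos.2 (by linarith [two_le_radicandEta ha hr φ])

theorem continuous_speedXi (a r : ℝ) : Continuous (speedXi a r) := by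
  unfold speedXi; fun_prop

theorem continuous_speedEta (a r : ℝ) : Continuous (speedEta a r) := by
  unfold speedEta; fun_prop

/-- The first integral of `ξ'' = 2hξ + 2ξ³` with `ξ' = 0` at `ξ² = r + a` factors as `ξ'² = (r + a -
ξ²)(-2h - (r + a) - ξ²)`. Dividing by `(r + a) sin² θ` yields the radicand of `speedXi`, whose
constant term `2 / r - 2 * r` vanishes at `r = 1`. -/
theorem hasDerivAt_velocityXi {a r : ℝ} (ha : |a| < r) (hr : r < 1) {θ : ℝ → ℝ} {s : ℝ}
    (hθ : HasDerivAt θ (speedXi a r (θ s)) s) :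
    HasDerivAt (fun s => -(√(r + a) * Real.sin (θ s) * speedXi a r (θ s)))
      (2 * (-1 / r - a) * (√(r + a) * Real.cos (θ s)) + 2 * (√(r + a) * Real.cos (θ s)) ^ 3) s := by
  have h1 : 0 < r + a := by linarith [neg_abs_le a]
  have hpos := radicandXi_pos ha hr (θ s)
  have hsp := speedXi_pos ha hr (θ s)
  have hsq : speedXi a r (θ s) ^ 2 = _ := Real.sq_sqrt hpos.le
  have hA := Real.sq_sqrt h1.le
  have hf : HasDerivAt (fun s => speedXi a r (θ s))
      ((r + a) * Real.sin (θ s) * Real.cos (θ s)) s := by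
    refine (((((hθ.sin).pow 2).const_mul (r + a)).const_add (2 / r - 2 * r)).sqrt
      hpos.ne').congr_deriv ?_
    change _ / (2 * speedXi a r (θ s)) = _
    field_simp
    push_cast
    ring
  refine (((hθ.sin.const_mul √(r + a)).mul hf).neg).congr_deriv ?_
  have hcs := Real.sin_sq_add_cos_sq (θ s)
  generalize speedXi a r (θ s) = f at *
  have h3 : √(r + a) ^ 3 = √(r + a) * (r + a) := by rw [pow_succ, hA]; ring
  rw [mul_pow, h3]
  linear_combination (-√(r + a) * Real.cos (θ s)) * hsq -
    2 * √(r + a) * Real.cos (θ s) * (r + a) * hcs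

theorem hasDerivAt_velocityEta {a r : ℝ} (ha : |a| < r) (hr : r < 1) {φ : ℝ → ℝ} {s : ℝ}
    (hφ : HasDerivAt φ (speedEta a r (φ s)) s) :
    HasDerivAt (fun s => -(√(r - a) * Real.sin (φ s) * speedEta a r (φ s)))
      (2 * (-1 / r - a) * (√(r - a) * Real.cos (φ s)) - 2 * (√(r - a) * Real.cos (φ s)) ^ 3) s := by
  have h1 : 0 < r - a := by linarith [le_abs_self a]
  have hpos : 0 < r + a + 2 / r + (r - a) * Real.cos (φ s) ^ 2 := by
    linarith [two_le_radicandEta ha hr (φ s)]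
  have hsp := speedEta_pos ha hr (φ s)
  have hsq : speedEta a r (φ s) ^ 2 = _ := Real.sq_sqrt hpos.le
  have hA := Real.sq_sqrt h1.le
  have hf : HasDerivAt (fun s => speedEta a r (φ s))
      (-((r - a) * Real.sin (φ s) * Real.cos (φ s))) s := by
    refine (((((hφ.cos).pow 2).const_mul (r - a)).const_add (r + a + 2 / r)).sqrt
      hpos.ne').congr_deriv ?_
    change _ / (2 * speedEta a r (φ s)) = _
    field_simp
    push_cast
    ring
  refine (((hφ.sin.const_mul √(r - a)).mul hf).neg).congr_deriv ?_
  have hcs := Real.sin_sq_add_cos_sq (φ s)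
  generalize speedEta a r (φ s) = f at *
  have h3 : √(r - a) ^ 3 = √(r - a) * (r - a) := by rw [pow_succ, hA]; ring
  rw [mul_pow, h3]
  linear_combination (-√(r - a) * Real.cos (φ s)) * hsq +
    √(r - a) * Real.cos (φ s) * (r - a) * hcs

theorem regularized_energy {a r : ℝ} (ha : |a| < r) (hr : r < 1) (θ φ : ℝ) :
    (-(√(r + a) * Real.sin θ * speedXi a r θ)) ^ 2 + (-(√(r - a) * Real.sin φ * speedEta a r φ)) ^ 2
      = 4 + 2 * (-1 / r - a) * ((√(r + a) * Real.cos θ) ^ 2 + (√(r - a) * Real.cos φ) ^ 2) +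
        ((√(r + a) * Real.cos θ) ^ 4 - (√(r - a) * Real.cos φ) ^ 4) := by
  have h0 : 0 < r := (abs_nonneg a).trans_lt ha
  have hA := Real.sq_sqrt (show 0 ≤ r + a by linarith [neg_abs_le a])
  have hD := Real.sq_sqrt (show 0 ≤ r - a by linarith [le_abs_self a])
  have h1 : speedXi a r θ ^ 2 = _ := Real.sq_sqrt (radicandXi_pos ha hr θ).le
  have h2 : speedEta a r φ ^ 2 = _ :=
    Real.sq_sqrt ((zero_le_two).trans (two_le_radicandEta ha hr φ))
  have hA4 : √(r + a) ^ 4 = (r + a) ^ 2 := by rw [show √(r + a) ^ 4 = (√(r + a) ^ 2) ^ 2 by ring, hA]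
  have hD4 : √(r - a) ^ 4 = (r - a) ^ 2 := by rw [show √(r - a) ^ 4 = (√(r - a) ^ 2) ^ 2 by ring, hD]
  simp only [neg_sq, mul_pow, h1, h2, hA, hD, hA4, hD4, Real.sin_sq]
  rw [show Real.cos θ ^ 4 = (Real.cos θ ^ 2) ^ 2 by ring,
    show Real.cos φ ^ 4 = (Real.cos φ ^ 2) ^ 2 by ring]
  field_simp
  ring

/-! ### Resonant orbits -/

/-- The zeros are the odd multiples of `π/2` strictly below `nπ/2`; both `n = 2k` and `n = 2k + 1`
leave exactly `k` of them, since the endpoint is excluded. -/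
theorem encard_zeros_cos_comp {ψ : ℝ → ℝ} (hψ : StrictMono ψ) (hsurj : Function.Surjective ψ)
    (h0 : ψ 0 = 0) {T : ℝ} {n k : ℕ} (hT : ψ T = n * (Real.pi / 2)) (h1 : 2 * k ≤ n)
    (h2 : n ≤ 2 * k + 1) :
    {t | t ∈ Ioo 0 T ∧ Real.cos (ψ t) = 0}.encard = (k : ℕ∞) := by
  choose χ hχ using hsurj
  have hpi := Real.pi_pos
  have himage : {t | t ∈ Ioo 0 T ∧ Real.cos (ψ t) = 0}
      = (fun j : ℕ => χ ((2 * j + 1) * Real.pi / 2)) '' (Finset.range k : Set ℕ) := by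
    ext t
    simp only [mem_ofPred_eq, mem_image, Finset.coe_range, mem_Iio, mem_Ioo]
    constructor
    · rintro ⟨⟨ht0, htT⟩, hc⟩
      obtain ⟨m, hm⟩ := Real.cos_eq_zero_iff.1 hc
      have e1 := hψ ht0
      have e2 := hψ htT
      rw [h0, hm] at e1
      rw [hT, hm] at e2
      have e3 : (0 : ℝ) < 2 * m + 1 := by
        by_contra! hcon
        nlinarith
      have e4 : (2 * m + 1 : ℝ) < n := by
        by_contra! hcon
        nlinarith
      have e5 : 0 < 2 * m + 1 := by exact_mod_cast e3
      have e6 : 2 * m + 1 < n := by exact_mod_cast e4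
      lift m to ℕ using by omega
      refine ⟨m, by omega, hψ.injective ?_⟩
      rw [hχ, hm]
      push_cast
      ring
    · rintro ⟨j, hj, rfl⟩
      have e1 : (2 * j + 1 : ℝ) < n := by
        have : 2 * j + 1 < n := by omega
        exact_mod_cast this
      refine ⟨⟨?_, ?_⟩, ?_⟩
      · rw [← hψ.lt_iff_lt, h0, hχ]
        positivity
      · rw [← hψ.lt_iff_lt, hT, hχ]
        nlinarith
      · rw [hχ, Real.cos_eq_zero_iff]
        exact ⟨j, by push_cast; ring⟩
  rw [himage, InjOn.encard_image, Set.encard_coe_eq_coe_finsetCard, Finset.card_range]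
  intro i _ j _ hij
  have := congrArg ψ hij
  simp only [hχ] at this
  have h3 : (i : ℝ) = j := by
    have := mul_right_cancel₀ hpi.ne' (show (2 * i + 1 : ℝ) * Real.pi = (2 * j + 1) * Real.pi by linarith)
    linarith
  exact_mod_cast h3

/-- The solution with initial position at distance `r < 1` from the origin, in the case in which
its quarter periods in the two parabolic coordinates are in an integer ratio `n`. -/
theorem exists_resonant_orbit {a r : ℝ} (ha : |a| < r) (hr : r < 1) {n : ℕ}
    (hres : quarterPeriod (speedXi a r) = n * quarterPeriod (speedEta a r)) :
    ∃ θ φ x y u v : ℝ → ℝ, ∃ P S T : ℝ, 0 < P ∧ S < 0 ∧ 0 < T ∧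
      StartsAtRest x y u v a √(r ^ 2 - a ^ 2) ∧
      StrictMono θ ∧ StrictMono φ ∧ Function.Surjective φ ∧ Continuous θ ∧ Continuous φ ∧
      θ 0 = 0 ∧ φ 0 = 0 ∧ θ T = Real.pi / 2 ∧ θ S = -(Real.pi / 2) ∧
      φ T = n * (Real.pi / 2) ∧
      Function.Periodic x P ∧ Function.Periodic y P ∧
      (∀ t, x t = ((√(r + a) * Real.cos (θ t)) ^ 2 - (√(r - a) * Real.cos (φ t)) ^ 2) / 2) ∧
      (∀ t, y t = (√(r + a) * Real.cos (θ t)) * (√(r - a) * Real.cos (φ t))) ∧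
      (u T * (√(r - a) * Real.cos (φ T)) ^ 2 = √(r - a) * Real.cos (φ T) *
        (√(r - a) * Real.sin (φ T) * speedEta a r (φ T))) ∧
      (v T * (√(r - a) * Real.cos (φ T)) ^ 2 =
        -(√(r + a) * speedXi a r (Real.pi / 2)) * (√(r - a) * Real.cos (φ T))) ∧
      (∀ t, Real.cos (θ t) = 0 → ∃ m : ℤ, φ t = (2 * m + 1) * n * (Real.pi / 2)) ∧
      ∀ I : Set ℝ, (∀ t ∈ I, Real.cos (θ t) ≠ 0 ∨ Real.cos (φ t) ≠ 0) →
        IsStarkSolutionOn x y u v I := by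
  have hra : 0 < r + a := by linarith [neg_abs_le a]
  have hrb : 0 < r - a := by linarith [le_abs_self a]
  have hA := Real.sqrt_pos.2 hra
  have hD := Real.sqrt_pos.2 hrb
  obtain ⟨θ, θmono, θcont, θsurj, θder, θmul, θadd⟩ := exists_phase (continuous_speedXi a r)
    (speedXi_pos ha hr) (fun s => by simp [speedXi]) (fun s => by simp [speedXi])
  obtain ⟨φ, φmono, φcont, φsurj, φder, φmul, φadd⟩ := exists_phase (continuous_speedEta a r)
    (speedEta_pos ha hr) (fun s => by simp [speedEta]) (fun s => by simp [speedEta])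
  have hTpos := quarterPeriod_pos (continuous_speedXi a r) (speedXi_pos ha hr)
  set T₁ := quarterPeriod (speedXi a r)
  set T₂ := quarterPeriod (speedEta a r)
  have θ0 : θ 0 = 0 := by simpa using θmul 0
  have φ0 : φ 0 = 0 := by simpa using φmul 0
  have θ1 : θ T₁ = Real.pi / 2 := by simpa using θmul 1
  have θ1' : θ (-T₁) = -(Real.pi / 2) := by simpa using θmul (-1)
  have φ1 : φ T₁ = n * (Real.pi / 2) := by simpa [hres] using φmul n
  have θP : ∀ s, θ (s + 4 * T₁) = θ s + 2 * Real.pi := fun s => by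
    have := θadd 2 s
    push_cast at this
    rw [← this]
    congr 1
    ring
  have φP : ∀ s, φ (s + 4 * T₁) = φ s + n * (2 * Real.pi) := fun s => by
    have := φadd (2 * n) s
    push_cast at this
    rw [hres, show (n : ℝ) * (2 * Real.pi) = 2 * n * Real.pi by ring, ← this]
    congr 1
    ring
  have cosθP : ∀ s, Real.cos (θ (s + 4 * T₁)) = Real.cos (θ s) := fun s => by
    rw [θP, Real.cos_add_two_pi]
  have cosφP : ∀ s, Real.cos (φ (s + 4 * T₁)) = Real.cos (φ s) := fun s => by
    rw [φP, Real.cos_add_nat_mul_two_pi]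
  set ξ : ℝ → ℝ := fun s => √(r + a) * Real.cos (θ s) with hξdef
  set η : ℝ → ℝ := fun s => √(r - a) * Real.cos (φ s) with hηdef
  set α : ℝ → ℝ := fun s => -(√(r + a) * Real.sin (θ s) * speedXi a r (θ s)) with hαdef
  set β : ℝ → ℝ := fun s => -(√(r - a) * Real.sin (φ s) * speedEta a r (φ s)) with hβdef
  have hξ : ∀ s, HasDerivAt ξ (α s) s := fun s =>
    ((θder s).cos.const_mul _).congr_deriv (by simp only [hαdef]; ring)
  have hη : ∀ s, HasDerivAt η (β s) s := fun s =>
    ((φder s).cos.const_mul _).congr_deriv (by simp only [hβdef]; ring)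
  set p : ℝ → ℝ := fun s => ξ s ^ 2 + η s ^ 2 with hpdef
  have hp : Continuous p := by
    simp only [hpdef, hξdef, hηdef]
    fun_prop
  have hpper : Function.Periodic p (4 * T₁) := fun s => by
    simp only [hpdef, hξdef, hηdef, cosθP, cosφP]
  -- The physical time is strictly increasing in `s` although `p` vanishes at collisions: if `p`
  -- vanished on an interval, then `ξ` and its derivative would vanish together there, but the zeros
  -- of `ξ` are simple.
  have hmono : StrictMono (primitive p) := by
    refine (monotone_of_hasDerivAt_nonneg (fun s => hasDerivAt_primitive hp s)
      (fun s => by simp only [hpdef, Pi.zero_apply]; positivity)).strictMono_of_injective ?_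
    have hinj : ∀ s₁ s₂, s₁ < s₂ → primitive p s₁ ≠ primitive p s₂ := by
      intro s₁ s₂ hlt heq
      have hM := monotone_of_hasDerivAt_nonneg (fun s => hasDerivAt_primitive hp s)
        (fun s => by simp only [hpdef, Pi.zero_apply]; positivity)
      have hconst : ∀ s ∈ Ioo s₁ s₂, primitive p s = primitive p s₁ := fun s hs =>
        le_antisymm ((hM hs.2.le).trans heq.ge) (hM hs.1.le)
      have hξ0 : ∀ s ∈ Ioo s₁ s₂, ξ s = 0 := fun s hs => by
        have h1 : p s = 0 := (hasDerivAt_primitive hp s).unique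
          ((hasDerivAt_const s (primitive p s₁)).congr_of_eventuallyEq
            (by filter_upwards [Ioo_mem_nhds hs.1 hs.2] with w hw using hconst w hw))
        have h2 : ξ s ^ 2 + η s ^ 2 = 0 := h1
        nlinarith [sq_nonneg (ξ s), sq_nonneg (η s)]
      obtain ⟨s, hs⟩ := nonempty_Ioo.2 hlt
      have hα0 : α s = 0 := (hξ s).unique ((hasDerivAt_const s (0 : ℝ)).congr_of_eventuallyEq
        (by filter_upwards [Ioo_mem_nhds hs.1 hs.2] with w hw using hξ0 w hw))
      have hc : Real.cos (θ s) = 0 := (mul_eq_zero.1 (hξ0 s hs)).resolve_left hA.ne'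
      have hs0 : Real.sin (θ s) = 0 := ((mul_eq_zero.1 ((mul_eq_zero.1 (neg_eq_zero.1
        hα0)).resolve_right (speedXi_pos ha hr _).ne')).resolve_left hA.ne')
      have := Real.sin_sq_add_cos_sq (θ s)
      simp [hc, hs0] at this
    intro s₁ s₂ heq
    rcases lt_trichotomy s₁ s₂ with h | h | h
    · exact (hinj _ _ h heq).elim
    · exact h
    · exact (hinj _ _ h heq.symm).elim
  obtain ⟨g, hg1, hg2, hg3, hg4, hg5⟩ :=
    exists_inverse_primitive hp (by positivity : 0 < 4 * T₁) hpper hmono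
  have g0 : g 0 = 0 := by
    have := hg1 0
    rwa [primitive_zero] at this
  have hgadd : ∀ t, g (t + primitive p (4 * T₁)) = g t + 4 * T₁ := fun t => by
    rw [← hg1 (g t + 4 * T₁), primitive_add_period hp hpper, hg2]
  have hpne : ∀ s, Real.cos (θ s) ≠ 0 ∨ Real.cos (φ s) ≠ 0 → p s ≠ 0 := by
    intro s hs
    simp only [hpdef, hξdef, hηdef]
    rcases hs with hs | hs <;> positivity
  refine ⟨fun t => θ (g t), fun t => φ (g t), fun t => (ξ (g t) ^ 2 - η (g t) ^ 2) / 2,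
    fun t => ξ (g t) * η (g t),
    fun t => (ξ (g t) * α (g t) - η (g t) * β (g t)) / (ξ (g t) ^ 2 + η (g t) ^ 2),
    fun t => (α (g t) * η (g t) + ξ (g t) * β (g t)) / (ξ (g t) ^ 2 + η (g t) ^ 2),
    primitive p (4 * T₁), primitive p (-T₁), primitive p T₁, ?_, ?_, ?_, ⟨?_, ?_, ?_, ?_⟩, θmono.comp hg3, φmono.comp hg3,
    fun w => ?_, θcont.comp hg4, φcont.comp hg4, by simp [g0, θ0], by simp [g0, φ0],
    by simp only [hg1, θ1], by simp only [hg1, θ1'], by simp only [hg1, φ1], fun t => ?_, fun t => ?_,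
    fun t => rfl, fun t => rfl, ?_, ?_, fun t ht => ?_, fun I hI => ?_⟩
  · have := hmono (show 0 < 4 * T₁ by positivity)
    rwa [primitive_zero] at this
  · have := hmono (neg_lt_zero.2 hTpos)
    rwa [primitive_zero] at this
  · have := hmono hTpos
    rwa [primitive_zero] at this
  · simp only [g0, hξdef, hηdef, θ0, φ0, Real.cos_zero, mul_one, Real.sq_sqrt hra.le,
      Real.sq_sqrt hrb.le]
    ring
  · simp only [g0, hξdef, hηdef, θ0, φ0, Real.cos_zero, mul_one]
    rw [← Real.sqrt_mul hra.le]
    congr 1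
    ring
  · simp [g0, hαdef, hβdef, θ0, φ0]
  · simp [g0, hαdef, hβdef, θ0, φ0]
  · obtain ⟨s, hs⟩ := φsurj w
    exact ⟨primitive p s, by simp only [hg1, hs]⟩
  · simp only [hgadd, hξdef, hηdef, cosθP, cosφP]
  · simp only [hgadd, hξdef, hηdef, cosθP, cosφP]
  -- The velocity identities are multiplied by `η ^ 2` so that they also hold when the orbit
  -- collides at this time.
  · simp only [hg1, hξdef, hηdef, hαdef, hβdef, θ1, Real.cos_pi_div_two]
    by_cases hc : Real.cos (φ T₁) = 0
    · simp [hc]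
    · field_simp
      ring
  · simp only [hg1, hξdef, hηdef, hαdef, hβdef, θ1, Real.cos_pi_div_two, Real.sin_pi_div_two]
    by_cases hc : Real.cos (φ T₁) = 0
    · simp [hc]
    · field_simp
      ring
  · obtain ⟨m, hm⟩ := Real.cos_eq_zero_iff.1 ht
    have h1 := θmul (2 * m + 1)
    have h2 : g t = (2 * m + 1 : ℤ) * T₁ := by
      apply θmono.injective
      rw [h1]
      refine hm.trans ?_
      push_cast
      ring
    refine ⟨m, ?_⟩
    have h3 := φmul ((2 * m + 1) * n)
    push_cast at h2 h3
    simp only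
    rw [h2, hres, ← mul_assoc, h3]
  · exact isStarkSolutionOn_of_regularized hξ hη (fun s => hasDerivAt_velocityXi ha hr (θder s))
      (fun s => hasDerivAt_velocityEta ha hr (φder s))
      (fun s => regularized_energy ha hr (θ s) (φ s)) (fun t ht => hpne _ (hI t ht))
      (fun t ht => hg5 t (hpne _ (hI t ht)))

theorem isTypeA_of_resonance {a r : ℝ} (ha : |a| < r) (hr : r < 1) {k : ℕ}
    (hres : quarterPeriod (speedXi a r) = (2 * k : ℕ) * quarterPeriod (speedEta a r)) :
    IsTypeA a √(r ^ 2 - a ^ 2) k := by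
  obtain ⟨θ, φ, x, y, u, v, P, S, T, hP, -, hT, hstart, θmono, φmono, φsurj, -, -, θ0, φ0, θT, -,
    φT, xP, yP, hx, hy, hu, hv, hcoll, hsol⟩ := exists_resonant_orbit ha hr hres
  have hA := Real.sqrt_pos.2 (show 0 < r + a by linarith [neg_abs_le a])
  have hD := Real.sqrt_pos.2 (show 0 < r - a by linarith [le_abs_self a])
  have hφT : φ T = k * Real.pi := by rw [φT]; push_cast; ring
  have hsinT : Real.sin (φ T) = 0 := by rw [hφT, Real.sin_nat_mul_pi]
  have hcosT : Real.cos (φ T) ≠ 0 := by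
    intro h
    have := Real.sin_sq_add_cos_sq (φ T)
    simp [h, hsinT] at this
  have hcosθ : ∀ t ∈ Ioo 0 T, 0 < Real.cos (θ t) := fun t ht => by
    have h1 := θmono ht.1
    have h2 := θmono ht.2
    rw [θ0] at h1
    rw [θT] at h2
    exact Real.cos_pos_of_mem_Ioo ⟨by linarith [Real.pi_pos], h2⟩
  have hcosφ : ∀ t ∈ Ioo 0 T, (y t = 0 ↔ Real.cos (φ t) = 0) := fun t ht => by
    rw [hy]
    simp [hA.ne', hD.ne', (hcosθ t ht).ne']
  have hxpos : ∀ t ∈ Ioo 0 T, y t = 0 → 0 < x t := fun t ht h => by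
    rw [hx, (hcosφ t ht).1 h]
    have := hcosθ t ht
    simp only [mul_zero, ne_eq, OfNat.ofNat_ne_zero, not_false_eq_true, zero_pow, sub_zero]
    positivity
  refine ⟨x, y, u, v, hstart, ⟨hsol univ fun t _ => ?_, ⟨P, hP, xP, yP⟩, 0, hstart.u_zero,
    hstart.v_zero⟩, T, hT, ⟨?_, ?_, ?_, ?_⟩, hxpos, ?_⟩
  -- With `n` even, `φ` is a multiple of `π` at every zero of `ξ`, so `η` is extremal there and no
  -- collision ever occurs.
  · by_contra! hcon
    obtain ⟨m, hm⟩ := hcoll t hcon.1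
    have h1 : φ t = ((2 * m + 1) * k : ℤ) * Real.pi := by rw [hm]; push_cast; ring
    have h2 := Real.sin_sq_add_cos_sq (φ t)
    rw [hcon.2, h1, Real.sin_int_mul_pi] at h2
    simp at h2
  · rw [hy, θT]
    simp
  · rw [hx, θT, Real.cos_pi_div_two]
    have : 0 < (√(r - a) * Real.cos (φ T)) ^ 2 := by positivity
    linarith
  · rw [hsinT] at hu
    simpa [hcosT, hD.ne'] using hu
  · intro h
    rw [h] at hv
    simp [hcosT, hD.ne', hA.ne', (speedXi_pos ha hr _).ne'] at hv
  · rw [← encard_zeros_cos_comp φmono φsurj φ0 φT (k := k) le_rfl (by omega)]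
    congr 1
    ext t
    exact ⟨fun h => ⟨h.1, (hcosφ t h.1).1 h.2.1⟩,
      fun h => ⟨h.1, (hcosφ t h.1).2 h.2, hxpos t h.1 ((hcosφ t h.1).2 h.2)⟩⟩

theorem isTypeB_of_resonance {a r : ℝ} (ha : |a| < r) (hr : r < 1) {k : ℕ}
    (hres : quarterPeriod (speedXi a r) = (2 * k + 1 : ℕ) * quarterPeriod (speedEta a r)) :
    IsTypeB a √(r ^ 2 - a ^ 2) k := by
  obtain ⟨θ, φ, x, y, u, v, P, S, T, hP, hS, hT, hstart, θmono, φmono, φsurj, θcont, φcont, θ0, φ0,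
    θT, θS, φT, xP, yP, hx, hy, -, -, -, hsol⟩ := exists_resonant_orbit ha hr hres
  have hA := Real.sqrt_pos.2 (show 0 < r + a by linarith [neg_abs_le a])
  have hD := Real.sqrt_pos.2 (show 0 < r - a by linarith [le_abs_self a])
  have hcosT : Real.cos (φ T) = 0 := by
    rw [φT, Real.cos_eq_zero_iff]
    exact ⟨k, by push_cast; ring⟩
  have hcosθ : ∀ t ∈ Ioo S T, 0 < Real.cos (θ t) := fun t ht => by
    have h1 := θmono ht.1
    have h2 := θmono ht.2
    rw [θS] at h1
    rw [θT] at h2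
    exact Real.cos_pos_of_mem_Ioo ⟨h1, h2⟩
  have hsub : ∀ t ∈ Ioo 0 T, t ∈ Ioo S T := fun t ht => ⟨hS.trans ht.1, ht.2⟩
  have hcosφ : ∀ t ∈ Ioo 0 T, (y t = 0 ↔ Real.cos (φ t) = 0) := fun t ht => by
    rw [hy]
    simp [hA.ne', hD.ne', (hcosθ t (hsub t ht)).ne']
  have hxpos : ∀ t ∈ Ioo 0 T, y t = 0 → 0 < x t := fun t ht h => by
    rw [hx, (hcosφ t ht).1 h]
    have := hcosθ t (hsub t ht)
    simp only [mul_zero, ne_eq, OfNat.ofNat_ne_zero, not_false_eq_true, zero_pow, sub_zero]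
    positivity
  have hxc : Continuous x := by
    rw [funext hx]
    fun_prop
  have hyc : Continuous y := by
    rw [funext hy]
    fun_prop
  -- The interval from `S` to `T` lies between consecutive zeros of `ξ`, hence is free of
  -- collisions.
  refine ⟨x, y, u, v, hstart, S, T, hS, hT, hsol _ fun t ht => Or.inl (hcosθ t ht).ne', ?_, ?_, ?_⟩
  · have h : x T = 0 := by rw [hx, θT, hcosT]; simp
    exact h ▸ hxc.continuousAt.tendsto.mono_left nhdsWithin_le_nhds
  · have h : y T = 0 := by rw [hy, θT]; simp
    exact h ▸ hyc.continuousAt.tendsto.mono_left nhdsWithin_le_nhds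
  · rw [← encard_zeros_cos_comp φmono φsurj φ0 φT (k := k) (by omega) le_rfl]
    congr 1
    ext t
    exact ⟨fun h => ⟨h.1, (hcosφ t h.1).1 h.2.1⟩,
      fun h => ⟨h.1, (hcosφ t h.1).2 h.2, hxpos t h.1 ((hcosφ t h.1).2 h.2)⟩⟩

/-! ### Existence of the two sequences -/

/-- A continuous function on `(b, e)` with limit `+∞` at `e` takes all large integer values, and the
points at which it does so for the last time increase to `e`. -/
theorem exists_last_crossings {f : ℝ → ℝ} {b e : ℝ} (hbe : b < e) (hf : ContinuousOn f (Ioo b e))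
    (hlim : Tendsto f (𝓝[<] e) atTop) :
    ∃ N : ℕ, ∃ s : ℕ → ℝ, (∀ n, N ≤ n → s n ∈ Ioo b e ∧ f (s n) = n ∧ s n < s (n + 1)) ∧
      Tendsto s atTop (𝓝 e) := by
  obtain ⟨c, hbc, hce⟩ := exists_between hbe
  obtain ⟨N, hN⟩ := exists_nat_ge (f c)
  have hex : ∀ n : ℕ, ∃ m, N ≤ n → m ∈ Ico c e ∧ f m = n ∧ ∀ t ∈ Ioo m e, (n : ℝ) < f t := by
    intro n
    by_cases hn : N ≤ n
    swap
    · exact ⟨0, fun h => (hn h).elim⟩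
    obtain ⟨l, hl, hsub⟩ := mem_nhdsLT_iff_exists_Ioo_subset.1 (hlim.eventually_gt_atTop (n : ℝ))
    have hle : max l c < e := max_lt hl hce
    have hcont : ContinuousOn f (Icc c (max l c)) :=
      hf.mono fun t ht => ⟨hbc.trans_le ht.1, ht.2.trans_lt hle⟩
    have hclosed : IsClosed (Icc c (max l c) ∩ f ⁻¹' Iic (n : ℝ)) :=
      hcont.preimage_isClosed_of_isClosed isClosed_Icc isClosed_Iic
    have hcomp : IsCompact (Icc c (max l c) ∩ f ⁻¹' Iic (n : ℝ)) :=
      isCompact_Icc.of_isClosed_subset hclosed inter_subset_left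
    -- Beyond `l` the function exceeds `n`, so the last point with `f ≤ n` can be sought on a
    -- compact interval; `f c ≤ N ≤ n` makes the set nonempty.
    obtain ⟨m, ⟨hm1, hm2⟩, hmax⟩ := hcomp.exists_isGreatest
      ⟨c, ⟨le_rfl, le_max_right _ _⟩, hN.trans (by exact_mod_cast hn)⟩
    have hgt : ∀ t ∈ Ioo m e, (n : ℝ) < f t := by
      intro t ht
      by_cases htl : t ≤ max l c
      · by_contra! hcon
        exact (hmax ⟨⟨hm1.1.trans ht.1.le, htl⟩, hcon⟩).not_gt ht.1
      · exact hsub ⟨(le_max_left _ _).trans_lt (not_le.1 htl), ht.2⟩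
    have hme : m < e := hm1.2.trans_lt hle
    refine ⟨m, fun _ => ⟨⟨hm1.1, hme⟩, le_antisymm hm2 ?_, hgt⟩⟩
    have hcm : ContinuousAt f m := hf.continuousAt (Ioo_mem_nhds (hbc.trans_le hm1.1) hme)
    refine ge_of_tendsto (hcm.tendsto.mono_left (nhdsWithin_le_nhds (s := Ioi m))) ?_
    filter_upwards [Ioo_mem_nhdsGT hme] with t ht using (hgt t ht).le
  choose s hs using hex
  refine ⟨N, s, fun n hn => ?_, ?_⟩
  · obtain ⟨h1, h2, h3⟩ := hs n hn
    obtain ⟨k1, k2, k3⟩ := hs (n + 1) (by omega)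
    refine ⟨⟨hbc.trans_le h1.1, h1.2⟩, h2, ?_⟩
    -- Past the last crossing of `n + 1` the function stays above `n + 1`, so the last crossing of
    -- `n` cannot lie there. No monotonicity of `f` is needed.
    by_contra! hcon
    rcases hcon.lt_or_eq with h | h
    · have := k3 _ ⟨h, h1.2⟩
      rw [h2] at this
      push_cast at this
      linarith
    · rw [h, h2] at k2
      push_cast at k2
      linarith
  · rw [tendsto_order]
    refine ⟨fun l hl => ?_, fun l hl => ?_⟩
    · have hle : max l c < e := max_lt hl hce
      have hcont : ContinuousOn f (Icc c (max l c)) :=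
        hf.mono fun t ht => ⟨hbc.trans_le ht.1, ht.2.trans_lt hle⟩
      obtain ⟨M, hM⟩ := (isCompact_Icc.image_of_continuousOn hcont).bddAbove
      obtain ⟨K, hK⟩ := exists_nat_gt M
      filter_upwards [eventually_ge_atTop (max N K)] with n hn
      obtain ⟨h1, h2, -⟩ := hs n ((le_max_left _ _).trans hn)
      by_contra! hcon
      have := hM (mem_image_of_mem f ⟨h1.1, hcon.trans (le_max_left _ _)⟩)
      rw [h2] at this
      have h4 : (K : ℝ) ≤ n := by exact_mod_cast (le_max_right _ _).trans hn
      linarith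
    · filter_upwards [eventually_ge_atTop N] with n hn using (hs n hn).1.2.trans hl

theorem continuousOn_quarterPeriod {f : ℝ → ℝ → ℝ} {I : Set ℝ}
    (hf : Continuous fun q : I × ℝ => f q.1 q.2) (hpos : ∀ r ∈ I, ∀ θ, 0 < f r θ) :
    ContinuousOn (fun r => quarterPeriod (f r)) I := by
  rw [continuousOn_iff_continuous_domRestrict]
  exact intervalIntegral.continuous_parametric_intervalIntegral_of_continuous'
    (f := fun (r : I) θ => (f r θ)⁻¹) (hf.inv₀ fun q => (hpos q.1 q.1.2 q.2).ne') _ _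

theorem continuousOn_quarterPeriod_speedXi (a : ℝ) :
    ContinuousOn (fun r => quarterPeriod (speedXi a r)) (Ioo |a| 1) := by
  refine continuousOn_quarterPeriod ?_ fun r hr θ => speedXi_pos hr.1 hr.2 θ
  unfold speedXi
  have : ∀ q : Ioo |a| 1 × ℝ, (q.1 : ℝ) ≠ 0 := fun q => ((abs_nonneg a).trans_lt q.1.2.1).ne'
  fun_prop (disch := assumption)

theorem continuousOn_quarterPeriod_speedEta (a : ℝ) :
    ContinuousOn (fun r => quarterPeriod (speedEta a r)) (Ioo |a| 1) := by
  refine continuousOn_quarterPeriod ?_ fun r hr θ => speedEta_pos hr.1 hr.2 θ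
  unfold speedEta
  have : ∀ q : Ioo |a| 1 × ℝ, (q.1 : ℝ) ≠ 0 := fun q => ((abs_nonneg a).trans_lt q.1.2.1).ne'
  fun_prop (disch := assumption)

theorem quarterPeriod_speedEta_le {a r : ℝ} (ha : |a| < r) (hr : r < 1) :
    quarterPeriod (speedEta a r) ≤ Real.pi / 2 := by
  have hc : Continuous fun w => (speedEta a r w)⁻¹ :=
    (continuous_speedEta a r).inv₀ fun s => (speedEta_pos ha hr s).ne'
  calc quarterPeriod (speedEta a r) ≤ ∫ _ in (0 : ℝ)..(Real.pi / 2), (1 : ℝ) := by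
        refine intervalIntegral.integral_mono_on Real.pi_div_two_pos.le
          (hc.intervalIntegrable _ _) (continuous_const.intervalIntegrable _ _) fun w _ => ?_
        refine inv_le_one_of_one_le₀ (Real.one_le_sqrt.2 ?_)
        linarith [two_le_radicandEta ha hr w]
    _ = Real.pi / 2 := by simp

/-- With `δ² = 2 / r - 2 * r`, the bounds `r + a ≤ 2` and `sin² w ≤ w²` give speed at most `√(δ² +
2w²) ≤ δ + 2w`, whose reciprocal integrates to a logarithm that blows up as `δ → 0`. -/
theorem log_le_quarterPeriod_speedXi {a r : ℝ} (ha : |a| < r) (hr : r < 1) :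
    1 / 2 * Real.log (√(2 / r - 2 * r) + Real.pi) - 1 / 2 * Real.log √(2 / r - 2 * r)
      ≤ quarterPeriod (speedXi a r) := by
  have hε : 0 < 2 / r - 2 * r := by simpa using radicandXi_pos ha hr 0
  set δ := √(2 / r - 2 * r) with hδdef
  have hδ : 0 < δ := Real.sqrt_pos.2 hε
  have hδ2 : δ ^ 2 = 2 / r - 2 * r := Real.sq_sqrt hε.le
  have hc : Continuous fun w => (speedXi a r w)⁻¹ :=
    (continuous_speedXi a r).inv₀ fun s => (speedXi_pos ha hr s).ne'
  have hpos : ∀ w ∈ Icc 0 (Real.pi / 2), 0 < δ + 2 * w := fun w hw => by linarith [hw.1]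
  have hci : IntervalIntegrable (fun w => (δ + 2 * w)⁻¹) MeasureTheory.volume 0 (Real.pi / 2) := by
    apply ContinuousOn.intervalIntegrable
    rw [uIcc_of_le Real.pi_div_two_pos.le]
    exact ContinuousOn.inv₀ (by fun_prop) fun w hw => (hpos w hw).ne'
  calc 1 / 2 * Real.log (δ + Real.pi) - 1 / 2 * Real.log δ
      = ∫ w in (0 : ℝ)..(Real.pi / 2), (δ + 2 * w)⁻¹ := by
        rw [intervalIntegral.integral_eq_sub_of_hasDerivAt
          (f := fun w => 1 / 2 * Real.log (δ + 2 * w)) (fun w hw => ?_) hci]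
        · simp only [mul_zero, add_zero]
          rw [show 2 * (Real.pi / 2) = Real.pi by ring]
        · rw [uIcc_of_le Real.pi_div_two_pos.le] at hw
          refine (((((hasDerivAt_id w).const_mul 2).const_add δ).log
            (hpos w hw).ne').const_mul (1 / 2)).congr_deriv ?_
          have := (hpos w hw).ne'
          simp only [id]
          field_simp
    _ ≤ quarterPeriod (speedXi a r) := by
        refine intervalIntegral.integral_mono_on Real.pi_div_two_pos.le hci
          (hc.intervalIntegrable _ _) fun w hw => ?_
        refine inv_anti₀ (speedXi_pos ha hr w) (Real.sqrt_le_iff.2 ⟨(hpos w hw).le, ?_⟩)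
        have h1 : Real.sin w ^ 2 ≤ w ^ 2 := by
          rw [sq_le_sq]
          exact Real.abs_sin_le_abs
        have h2 : r + a ≤ 2 := by linarith [le_abs_self a]
        have h3 : 0 ≤ r + a := by linarith [neg_abs_le a]
        have h4 : (r + a) * Real.sin w ^ 2 ≤ 2 * w ^ 2 := by gcongr
        nlinarith [mul_nonneg hδ.le hw.1]

theorem tendsto_quarterPeriod_ratio {a : ℝ} (ha : |a| < 1) :
    Tendsto (fun r => quarterPeriod (speedXi a r) / quarterPeriod (speedEta a r)) (𝓝[<] 1)
      atTop := by
  have hδ0 : Tendsto (fun r : ℝ => √(2 / r - 2 * r)) (𝓝[<] 1) (𝓝 0) := by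
    have h : ContinuousAt (fun r : ℝ => √(2 / r - 2 * r)) 1 := by
      have : (1 : ℝ) ≠ 0 := one_ne_zero
      fun_prop (disch := assumption)
    have h' := h.tendsto.mono_left (nhdsWithin_le_nhds (s := Iio 1))
    simpa using h'
  have hmem : ∀ᶠ r in 𝓝[<] (1 : ℝ), r ∈ Ioo |a| 1 := Ioo_mem_nhdsLT ha
  have hδ : Tendsto (fun r : ℝ => √(2 / r - 2 * r)) (𝓝[<] 1) (𝓝[>] 0) := by
    refine tendsto_nhdsWithin_iff.2 ⟨hδ0, ?_⟩
    filter_upwards [hmem] with r hr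
    exact Real.sqrt_pos.2 (by simpa using radicandXi_pos hr.1 hr.2 0)
  have hlog : Tendsto (fun r : ℝ => -Real.log √(2 / r - 2 * r)) (𝓝[<] 1) atTop :=
    tendsto_neg_atBot_atTop.comp (Real.tendsto_log_nhdsGT_zero.comp hδ)
  have hpi : (0 : ℝ) < 1 / Real.pi := by positivity
  refine tendsto_atTop_mono' _ ?_ (hlog.const_mul_atTop hpi)
  filter_upwards [hmem] with r hr
  have h1 := log_le_quarterPeriod_speedXi hr.1 hr.2
  have h2 := quarterPeriod_speedEta_le hr.1 hr.2
  have h3 := quarterPeriod_pos (continuous_speedEta a r) (speedEta_pos hr.1 hr.2)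
  have h4 := quarterPeriod_pos (continuous_speedXi a r) (speedXi_pos hr.1 hr.2)
  have h5 : 0 ≤ Real.log (√(2 / r - 2 * r) + Real.pi) :=
    Real.log_nonneg (by linarith [Real.sqrt_nonneg (2 / r - 2 * r), Real.pi_gt_three])
  calc 1 / Real.pi * -Real.log √(2 / r - 2 * r)
      ≤ 1 / Real.pi * (2 * quarterPeriod (speedXi a r)) := by gcongr; linarith
    _ = quarterPeriod (speedXi a r) / (Real.pi / 2) := by field_simp
    _ ≤ _ := by gcongr

theorem exists_isAdmissibleIndex {a : ℝ} (ha : |a| < 1) : ∃ kb, IsAdmissibleIndex a kb := by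
  obtain ⟨N, s, hs, hlim⟩ := exists_last_crossings ha
    ((continuousOn_quarterPeriod_speedXi a).div (continuousOn_quarterPeriod_speedEta a)
      fun r hr => (quarterPeriod_pos (continuous_speedEta a r) (speedEta_pos hr.1 hr.2)).ne')
    (tendsto_quarterPeriod_ratio ha)
  have hres : ∀ n, N ≤ n →
      quarterPeriod (speedXi a (s n)) = n * quarterPeriod (speedEta a (s n)) := fun n hn => by
    obtain ⟨h1, h2, -⟩ := hs n hn
    have h3 := quarterPeriod_pos (continuous_speedEta a (s n)) (speedEta_pos h1.1 h1.2)
    exact (div_eq_iff h3.ne').1 h2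
  have hpos : ∀ n, N ≤ n → 0 < √(s n ^ 2 - a ^ 2) := fun n hn => by
    have h1 := (hs n hn).1.1
    refine Real.sqrt_pos.2 (sub_pos.2 (sq_lt_sq.2 (h1.trans_le (le_abs_self _))))
  have hlt : ∀ n, N ≤ n → √(s n ^ 2 - a ^ 2) < √(s (n + 1) ^ 2 - a ^ 2) := fun n hn => by
    obtain ⟨h1, -, h3⟩ := hs n hn
    have h0 : 0 ≤ s n := (abs_nonneg a).trans h1.1.le
    refine Real.sqrt_lt_sqrt (Real.sqrt_pos.1 (hpos n hn)).le ?_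
    gcongr
  have htend : Tendsto (fun n => √(s n ^ 2 - a ^ 2)) atTop (𝓝 √(1 - a ^ 2)) := by
    have h : Continuous fun w : ℝ => √(w ^ 2 - a ^ 2) := by fun_prop
    have := (h.tendsto 1).comp hlim
    simpa [Function.comp_def] using this
  -- Even and odd resonances of one increasing sequence of radii give `d` and `d'`, so their
  -- interlacing is automatic.
  refine ⟨N, fun k => √(s (2 * k) ^ 2 - a ^ 2), fun k => √(s (2 * k + 1) ^ 2 - a ^ 2),
    fun k hk => ⟨hpos _ (by omega), ?_⟩, fun k hk => ⟨hpos _ (by omega), ?_⟩, ?_, ?_,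
    fun k hk => ⟨hlt _ (by omega), hlt (2 * k + 1) (by omega)⟩⟩
  · obtain ⟨h1, -, -⟩ := hs (2 * k) (by omega)
    exact isTypeA_of_resonance h1.1 h1.2 (hres _ (by omega))
  · obtain ⟨h1, -, -⟩ := hs (2 * k + 1) (by omega)
    exact isTypeB_of_resonance h1.1 h1.2 (hres _ (by omega))
  · exact htend.comp (tendsto_atTop_mono (fun k : ℕ => by simp only [id]; omega) tendsto_id)
  · exact htend.comp (tendsto_atTop_mono (fun k : ℕ => by simp only [id]; omega) tendsto_id)

/-! ### Orbits near the equilibrium and growth of the index -/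

/-- Sturm comparison with `sin (t / 2)`: a solution of `y'' = -q y` with `q ≥ 1 / 4` is not positive
throughout an interval of length `2 * π`. -/
theorem not_forall_pos_of_sturm {y v q : ℝ → ℝ} {s : ℝ}
    (hy : ∀ t ∈ Icc s (s + 2 * Real.pi), HasDerivAt y (v t) t)
    (hv : ∀ t ∈ Icc s (s + 2 * Real.pi), HasDerivAt v (-(q t * y t)) t)
    (hq : ∀ t ∈ Icc s (s + 2 * Real.pi), 1 / 4 ≤ q t)
    (hpos : ∀ t ∈ Icc s (s + 2 * Real.pi), 0 < y t) : False := by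
  have hpi := Real.pi_pos
  have hle : s ≤ s + 2 * Real.pi := by linarith
  -- The Wronskian of `y` and `sin ((t - s) / 2)`: it cannot increase while `y > 0`, yet it equals
  -- `-y / 2` at the left end and `y / 2` at the right end.
  set W : ℝ → ℝ := fun t => v t * Real.sin ((t - s) / 2) - y t * (Real.cos ((t - s) / 2) / 2)
  have hS : ∀ t, HasDerivAt (fun t => Real.sin ((t - s) / 2)) (Real.cos ((t - s) / 2) / 2) t :=
    fun t => ((((hasDerivAt_id t).sub_const s).div_const 2).sin).congr_deriv (by simp; ring)
  have hC : ∀ t, HasDerivAt (fun t => Real.cos ((t - s) / 2) / 2) (-Real.sin ((t - s) / 2) / 4) t :=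
    fun t => (((((hasDerivAt_id t).sub_const s).div_const 2).cos).div_const 2).congr_deriv
      (by simp; ring)
  have hW : ∀ t ∈ Icc s (s + 2 * Real.pi),
      HasDerivAt W (-((q t - 1 / 4) * y t * Real.sin ((t - s) / 2))) t := fun t ht =>
    (((hv t ht).mul (hS t)).sub ((hy t ht).mul (hC t))).congr_deriv (by ring)
  have hanti : AntitoneOn W (Icc s (s + 2 * Real.pi)) := by
    refine antitoneOn_of_hasDerivWithinAt_nonpos (convex_Icc _ _)
      (fun t ht => (hW t ht).continuousAt.continuousWithinAt)
      (fun t ht => (hW t (interior_subset ht)).hasDerivWithinAt) fun t ht => ?_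
    have ht' := interior_subset ht
    have h1 := hpos t ht'
    have h2 := sub_nonneg.2 (hq t ht')
    have h3 : 0 ≤ Real.sin ((t - s) / 2) :=
      Real.sin_nonneg_of_nonneg_of_le_pi (by linarith [ht'.1]) (by linarith [ht'.2])
    have := mul_nonneg (mul_nonneg h2 h1.le) h3
    linarith
  have h := hanti (left_mem_Icc.2 hle) (right_mem_Icc.2 hle) hle
  have h1 := hpos s (left_mem_Icc.2 hle)
  have h2 := hpos _ (right_mem_Icc.2 hle)
  have e : (s + 2 * Real.pi - s) / 2 = Real.pi := by ring
  simp only [W, e, sub_self, zero_div, Real.sin_zero, Real.cos_zero, Real.sin_pi, Real.cos_pi] at h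
  linarith

theorem exists_zero_of_sturm {y v q : ℝ → ℝ} {s : ℝ}
    (hy : ∀ t ∈ Icc s (s + 2 * Real.pi), HasDerivAt y (v t) t)
    (hv : ∀ t ∈ Icc s (s + 2 * Real.pi), HasDerivAt v (-(q t * y t)) t)
    (hq : ∀ t ∈ Icc s (s + 2 * Real.pi), 1 / 4 ≤ q t) :
    ∃ t ∈ Icc s (s + 2 * Real.pi), y t = 0 := by
  by_contra! hne
  have hle : s ≤ s + 2 * Real.pi := by linarith [Real.pi_pos]
  have hcont : ContinuousOn y (Icc s (s + 2 * Real.pi)) :=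
    fun t ht => (hy t ht).continuousAt.continuousWithinAt
  have hconn := (isPreconnected_Icc (a := s) (b := s + 2 * Real.pi))
  rcases (hne s (left_mem_Icc.2 hle)).lt_or_gt with hs | hs
  · refine not_forall_pos_of_sturm (y := fun t => -y t) (v := fun t => -v t) (q := q)
      (fun t ht => (hy t ht).neg) (fun t ht => (hv t ht).neg.congr_deriv (by ring)) hq
      fun t ht => ?_
    by_contra! hcon
    obtain ⟨w, hw, hw0⟩ := hconn.intermediate_value (left_mem_Icc.2 hle) ht hcont
      ⟨hs.le, by linarith⟩
    exact hne w hw hw0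
  · refine not_forall_pos_of_sturm hy hv hq fun t ht => ?_
    by_contra! hcon
    obtain ⟨w, hw, hw0⟩ := hconn.intermediate_value ht (left_mem_Icc.2 hle) hcont ⟨hcon, hs.le⟩
    exact hne w hw hw0

/-- The force of the Stark problem is at most linear in the distance from the equilibrium `(1, 0)`. -/
theorem abs_force_le {x y : ℝ} (h : (x - 1) ^ 2 + y ^ 2 < 1 / 16) :
    |-(x / √(x ^ 2 + y ^ 2) ^ 3) + 1| ≤ 10 * (|x - 1| + |y|) ∧
      |-(y / √(x ^ 2 + y ^ 2) ^ 3)| ≤ 10 * |y| ∧ 3 / 4 ≤ x ∧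
      1 / 4 ≤ 1 / √(x ^ 2 + y ^ 2) ^ 3 := by
  set r := √(x ^ 2 + y ^ 2) with hr
  have hr2 : r ^ 2 = x ^ 2 + y ^ 2 := Real.sq_sqrt (by positivity)
  have hr0 : 0 ≤ r := Real.sqrt_nonneg _
  obtain ⟨hx1, hx2⟩ : -(1 / 4) ≤ x - 1 ∧ x - 1 ≤ 1 / 4 := abs_le.1
    (abs_le_of_sq_le_sq (by nlinarith [sq_nonneg y]) (by norm_num))
  obtain ⟨hy1, hy2⟩ : -(1 / 4) ≤ y ∧ y ≤ 1 / 4 := abs_le.1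
    (abs_le_of_sq_le_sq (by nlinarith [sq_nonneg (x - 1)]) (by norm_num))
  have hxr : x ≤ r := Real.le_sqrt_of_sq_le (by nlinarith [sq_nonneg y])
  have hr3 : 3 / 4 ≤ r := by linarith
  have hr4 : r ≤ 5 / 4 := by nlinarith
  have hrx : r - x ≤ |y| := by
    have h1 : (r - x) * (r + x) = |y| ^ 2 := by rw [sq_abs]; linarith
    have h2 : |y| ≤ 1 / 4 := abs_le.2 ⟨hy1, hy2⟩
    nlinarith [abs_nonneg y]
  have hcub : 27 / 64 ≤ r ^ 3 := by
    calc (27 / 64 : ℝ) = (3 / 4) ^ 3 := by norm_num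
      _ ≤ r ^ 3 := by gcongr
  have hcub2 : r ^ 3 ≤ 125 / 64 := by
    calc r ^ 3 ≤ (5 / 4) ^ 3 := by gcongr
      _ = 125 / 64 := by norm_num
  have hr3pos : 0 < r ^ 3 := by linarith
  have hr1 : |r - 1| ≤ |x - 1| + |y| := by
    have h1 : |r - x| ≤ |y| := by rw [abs_of_nonneg (by linarith)]; exact hrx
    calc |r - 1| = |(x - 1) + (r - x)| := by congr 1; ring
      _ ≤ |x - 1| + |r - x| := abs_add_le _ _
      _ ≤ _ := by linarith
  refine ⟨?_, ?_, by linarith, ?_⟩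
  · rw [show -(x / r ^ 3) + 1 = (r ^ 3 - x) / r ^ 3 by field_simp; ring, abs_div,
      abs_of_pos hr3pos, div_le_iff₀ hr3pos]
    -- Here `45/16 = (5/4)(9/4)` bounds `r (r + 1)`; the total coefficient `61/16` is below `10 *
    -- (27/64)`.
    have h1 : |r ^ 3 - x| ≤ 45 / 16 * |r - 1| + |y| := by
      calc |r ^ 3 - x| = |r * (r + 1) * (r - 1) + (r - x)| := by congr 1; ring
        _ ≤ |r * (r + 1) * (r - 1)| + |r - x| := abs_add_le _ _
        _ = r * (r + 1) * |r - 1| + (r - x) := by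
          rw [abs_mul, abs_of_nonneg (by positivity : 0 ≤ r * (r + 1)),
            abs_of_nonneg (by linarith : 0 ≤ r - x)]
        _ ≤ 45 / 16 * |r - 1| + |y| := by
          gcongr
          nlinarith
    have h2 : 10 * (|x - 1| + |y|) * (27 / 64) ≤ 10 * (|x - 1| + |y|) * r ^ 3 := by gcongr
    linarith [abs_nonneg (x - 1), abs_nonneg y]
  · rw [abs_neg, abs_div, abs_of_pos hr3pos, div_le_iff₀ hr3pos]
    nlinarith [abs_nonneg y]
  · rw [div_le_div_iff₀ (by norm_num) hr3pos]
    linarith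

/-- A solution that starts at rest close to the equilibrium `(1, 0)` stays close to it for a long
time. -/
theorem near_equilibrium {x y u v : ℝ → ℝ} (hsol : IsStarkSolutionOn x y u v univ) {L : ℝ}
    (hE : ((x 0 - 1) ^ 2 + y 0 ^ 2 + u 0 ^ 2 + v 0 ^ 2) * Real.exp (22 * L) < 1 / 16) :
    ∀ t ∈ Icc 0 L, (x t - 1) ^ 2 + y t ^ 2 < 1 / 16 := by
  set E : ℝ → ℝ := fun t => (x t - 1) ^ 2 + y t ^ 2 + u t ^ 2 + v t ^ 2 with hEdef
  have hE0 : 0 ≤ E 0 := by simp only [hEdef]; positivity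
  have hder : ∀ t, HasDerivAt E (2 * (x t - 1) * u t + 2 * y t * v t +
      2 * u t * (-(x t / √(x t ^ 2 + y t ^ 2) ^ 3) + 1) +
      2 * v t * (-(y t / √(x t ^ 2 + y t ^ 2) ^ 3))) t := fun t =>
    ((((((hsol.deriv_x t trivial).sub_const 1).pow 2).add ((hsol.deriv_y t trivial).pow 2)).add
      ((hsol.deriv_u t trivial).pow 2)).add ((hsol.deriv_v t trivial).pow 2)).congr_deriv
      (by push_cast; ring)
  have hcont : Continuous E := continuous_iff_continuousAt.2 fun t => (hder t).continuousAt
  have hbound : ∀ t, E t < 1 / 16 → 2 * (x t - 1) * u t + 2 * y t * v t +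
      2 * u t * (-(x t / √(x t ^ 2 + y t ^ 2) ^ 3) + 1) +
      2 * v t * (-(y t / √(x t ^ 2 + y t ^ 2) ^ 3)) ≤ 22 * E t := by
    intro t ht
    obtain ⟨h1, h2, -, -⟩ := abs_force_le (x := x t) (y := y t)
      (by simp only [hEdef] at ht; nlinarith [sq_nonneg (u t), sq_nonneg (v t)])
    generalize -(x t / √(x t ^ 2 + y t ^ 2) ^ 3) + 1 = F at *
    generalize -(y t / √(x t ^ 2 + y t ^ 2) ^ 3) = G at *
    have e1 : (x t - 1) * u t ≤ |x t - 1| * |u t| := (le_abs_self _).trans (abs_mul _ _).le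
    have e2 : y t * v t ≤ |y t| * |v t| := (le_abs_self _).trans (abs_mul _ _).le
    have e3 : u t * F ≤ |u t| * (10 * (|x t - 1| + |y t|)) :=
      (le_abs_self _).trans ((abs_mul _ _).le.trans (by gcongr))
    have e4 : v t * G ≤ |v t| * (10 * |y t|) :=
      (le_abs_self _).trans ((abs_mul _ _).le.trans (by gcongr))
    have hEt : E t = |x t - 1| ^ 2 + |y t| ^ 2 + |u t| ^ 2 + |v t| ^ 2 := by
      simp only [hEdef, sq_abs]
    rw [hEt]
    nlinarith [sq_nonneg (|x t - 1| - |u t|), sq_nonneg (|y t| - |v t|),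
      sq_nonneg (|u t| - |y t|), sq_nonneg (|x t - 1|), sq_nonneg (|v t|), sq_nonneg (|y t|),
      sq_nonneg (|u t|)]
  -- Continuity argument: up to the first time at which `E` reaches `1/16` the linear force bound
  -- holds, so `E * exp (-22 t)` decreases and `E` is still too small at that time.
  have hmain : ∀ t ∈ Icc 0 L, E t < 1 / 16 := by
    by_contra! hcon
    obtain ⟨t, ht, htE⟩ := hcon
    obtain ⟨m, ⟨hm1, hm2⟩, hmin⟩ := (isCompact_Icc.inter_right
      (isClosed_le continuous_const hcont) :
        IsCompact (Icc 0 L ∩ {t | 1 / 16 ≤ E t})).exists_isLeast ⟨t, ht, htE⟩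
    have hlt : ∀ s ∈ Ioo 0 m, E s < 1 / 16 := by
      intro s hs
      by_contra! hcon
      exact (hmin ⟨⟨hs.1.le, hs.2.le.trans hm1.2⟩, hcon⟩).not_gt hs.2
    have hexp : ∀ s : ℝ, HasDerivAt (fun s => Real.exp (-22 * s)) (-22 * Real.exp (-22 * s)) s :=
      fun s => (((hasDerivAt_id s).const_mul (-22 : ℝ)).exp).congr_deriv (by simp; ring)
    have hanti : AntitoneOn (fun s => E s * Real.exp (-22 * s)) (Icc 0 m) := by
      refine antitoneOn_of_hasDerivWithinAt_nonpos (convex_Icc _ _)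
        (by fun_prop) (fun s hs => ((hder s).mul (hexp s)).hasDerivWithinAt) fun s hs => ?_
      rw [interior_Icc] at hs
      have h1 := hbound s (hlt s hs)
      nlinarith [Real.exp_pos (-22 * s)]
    have h := hanti (left_mem_Icc.2 hm1.1) (right_mem_Icc.2 hm1.1) hm1.1
    simp only [mul_zero, Real.exp_zero, mul_one] at h
    have h2 : E m ≤ E 0 * Real.exp (22 * m) := by
      calc E m = E m * Real.exp (-22 * m) * Real.exp (22 * m) := by
            rw [mul_assoc, ← Real.exp_add]
            simp
        _ ≤ _ := by gcongr
    have h3 : E 0 * Real.exp (22 * m) ≤ E 0 * Real.exp (22 * L) := by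
      gcongr
      exact hm1.2
    have h4 : 1 / 16 ≤ E m := hm2
    linarith
  intro t ht
  have := hmain t ht
  simp only [hEdef] at this
  nlinarith [sq_nonneg (u t), sq_nonneg (v t)]

/-- The orbit stays where `x > 0` up to time `7 (k + 2)`, so `T` comes later; by then Sturm
comparison has produced `k + 1` crossings of the positive axis. -/
theorem not_isTypeA_of_near_equilibrium {a d : ℝ} {k : ℕ}
    (h : ((a - 1) ^ 2 + d ^ 2) * Real.exp (22 * (7 * (k + 2))) < 1 / 16) : ¬ IsTypeA a d k := by
  rintro ⟨x, y, u, v, hstart, hbrake, T, hT, hhit, -, hcard⟩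
  have hsol := hbrake.solution
  have hnear := near_equilibrium hsol (L := 7 * (k + 2))
    (by simpa [hstart.x_zero, hstart.y_zero, hstart.u_zero, hstart.v_zero] using h)
  have hLT : 7 * ((k : ℝ) + 2) < T := by
    by_contra! hcon
    have := (abs_force_le (hnear T ⟨hT.le, hcon⟩)).2.2.1
    linarith [hhit.2.1]
  have hpi : 2 * Real.pi < 6.3 := by linarith [Real.pi_lt_d2]
  -- The windows have length `2π < 6.3` and are spaced by `7`, hence disjoint; the offset `1/2`
  -- keeps the zeros off the starting time.
  have hzero : ∀ i : ℕ, ∃ t, i ≤ k →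
      t ∈ Icc (7 * (i : ℝ) + 1 / 2) (7 * i + 1 / 2 + 2 * Real.pi) ∧ y t = 0 := by
    intro i
    by_cases hi : i ≤ k
    swap
    · exact ⟨0, fun h => (hi h).elim⟩
    have hik : (i : ℝ) ≤ k := by exact_mod_cast hi
    obtain ⟨t, ht, hyt⟩ := exists_zero_of_sturm (s := 7 * (i : ℝ) + 1 / 2) (y := y) (v := v)
      (q := fun t => 1 / √(x t ^ 2 + y t ^ 2) ^ 3) (fun t _ => hsol.deriv_y t trivial)
      (fun t _ => (hsol.deriv_v t trivial).congr_deriv (by ring))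
      (fun t ht => (abs_force_le (hnear t ⟨by
        have : (0 : ℝ) ≤ i := i.cast_nonneg
        linarith [ht.1], by linarith [ht.2]⟩)).2.2.2)
    exact ⟨t, fun _ => ⟨ht, hyt⟩⟩
  choose z hz using hzero
  have hsub : z '' (Finset.range (k + 1) : Set ℕ) ⊆ positiveAxisTimes x y T := by
    rintro _ ⟨i, hi, rfl⟩
    have hi' : i ≤ k := by
      simp only [Finset.coe_range, mem_Iio] at hi
      omega
    have hik : (i : ℝ) ≤ k := by exact_mod_cast hi'
    have hi0 : (0 : ℝ) ≤ i := i.cast_nonneg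
    obtain ⟨h1, h2⟩ := hz i hi'
    have h3 : z i ≤ 7 * ((k : ℝ) + 2) := by linarith [h1.2]
    have h4 : 0 < z i := by linarith [h1.1]
    refine ⟨⟨h4, h3.trans_lt hLT⟩, h2, ?_⟩
    linarith [(abs_force_le (hnear _ ⟨h4.le, h3⟩)).2.2.1]
  have hinj : InjOn z (Finset.range (k + 1) : Set ℕ) := by
    have hlt : ∀ i j : ℕ, i ≤ k → j ≤ k → i < j → z i < z j := by
      intro i j hi hj hij
      have h1 := (hz i hi).1.2
      have h2 := (hz j hj).1.1
      have h3 : (i : ℝ) + 1 ≤ j := by exact_mod_cast hij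
      linarith
    intro i hi j hj hij
    simp only [Finset.coe_range, mem_Iio] at hi hj
    rcases lt_trichotomy i j with h | h | h
    · exact absurd hij (hlt i j (by omega) (by omega) h).ne
    · exact h
    · exact absurd hij (hlt j i (by omega) (by omega) h).ne'
  have := encard_le_encard hsub
  rw [hinj.encard_image, Set.encard_coe_eq_coe_finsetCard, Finset.card_range, hcard] at this
  have h5 : k + 1 ≤ k := by exact_mod_cast this
  omega

theorem tendsto_admissibleIndex {kb : ℝ → ℕ}
    (hkb : ∀ a : ℝ, a ∈ Ioo (-1 : ℝ) 1 → IsAdmissibleIndex a (kb a)) :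
    Tendsto kb (𝓝[<] 1) atTop := by
  refine tendsto_atTop.2 fun K => ?_
  have hsmall : ∀ᶠ a in 𝓝[<] (1 : ℝ), (2 - 2 * a) * Real.exp (22 * (7 * (K + 2))) < 1 / 16 := by
    have hc : Continuous fun a : ℝ => (2 - 2 * a) * Real.exp (22 * (7 * (K + 2))) := by fun_prop
    exact ((hc.tendsto 1).mono_left nhdsWithin_le_nhds).eventually_lt_const (by norm_num)
  filter_upwards [hsmall, Ioo_mem_nhdsLT (show (-1 : ℝ) < 1 by norm_num)] with a ha hmem
  by_contra! hcon
  obtain ⟨d, d', hA, -, hlim, -, hord⟩ := hkb a hmem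
  have hlt : ∀ n, K ≤ n → d n < d (n + 1) := fun n hn =>
    (hord n (hcon.le.trans hn)).1.trans (hord n (hcon.le.trans hn)).2
  have hle : ∀ n, K ≤ n → d K ≤ d n := fun n hn => by
    induction n, hn using Nat.le_induction with
    | base => exact le_rfl
    | succ n hn ih => exact ih.trans (hlt n hn).le
  -- If the index were below `K`, then `d` would increase to its limit from `K` on. This bounds `d
  -- K` whatever the choice of sequences, and the initial squared distance to `(1, 0)` is then at
  -- most `2 - 2 * a`.
  have hdle : d K ≤ √(1 - a ^ 2) := ge_of_tendsto hlim
    (by filter_upwards [eventually_ge_atTop K] with n hn using hle n hn)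
  obtain ⟨hd0, htype⟩ := hA K hcon.le
  have h1 : 0 ≤ 1 - a ^ 2 := by nlinarith [hmem.1, hmem.2]
  have h2 : d K ^ 2 ≤ 1 - a ^ 2 := by
    calc d K ^ 2 ≤ √(1 - a ^ 2) ^ 2 := by gcongr
      _ = _ := Real.sq_sqrt h1
  refine not_isTypeA_of_near_equilibrium (lt_of_le_of_lt ?_ ha) htype
  gcongr
  nlinarith

theorem theorem3 :
    (∀ a : ℝ, a ∈ Set.Ioo (-1 : ℝ) 1 → ∃ kb : ℕ, IsAdmissibleIndex a kb) ∧
    (∀ kb : ℝ → ℕ,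
      (∀ a : ℝ, a ∈ Set.Ioo (-1 : ℝ) 1 → IsAdmissibleIndex a (kb a)) →
        Filter.Tendsto kb (nhdsWithin 1 (Set.Iio 1)) Filter.atTop) :=
  ⟨fun _ ha => exists_isAdmissibleIndex (abs_lt.2 ha), fun _ hkb => tendsto_admissibleIndex hkb⟩
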